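/- **Lemma A.2.** Let $\mathcal O\subset\mathbb R^d$ be open and bounded with boundary of class $C^1$ (in particular, any smooth boundary is allowed), that is, every $p\in\partial\mathcal O$ has an open neighbourhood $U$ with a function $\rho\in C^1(U)$ such that $\nabla\rho\neq0$ on $U$ and $\mathcal O\cap U=\{x\in U:\rho(x)<0\}$. Let $\nu:\partial\mathcal O\to\mathbb R^d$ be the outer unit normal, and let $b=(b^1,\dots,b^d)\in C^2(\overline{\mathcal O};\mathbb R^d)$. Then $b$ is a Killing vector field, i.e. $$\partial_j b^i+\partial_i b^j=0\quad\text{on }\overline{\mathcal O}\text{ for all }1\le i,j\le d,$$ if and only if $$\langle\Delta b,b\rangle=0\quad\text{and}\quad\operatorname{div}b=0\quad\text{on }\overline{\mathcal O},$$ and $$\sum_{1\le i,j\le d}(\partial_j b^i+\partial_i b^j)\,\nu_j\,b^i=0\quad\text{on }\partial\mathcal O,$$ where the Laplace operator acts componentwise. -/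

import Mathlib

/-- `ρ` is a `C¹` defining function of the set `O` on the open neighbourhood `U` of `p`:
inside `U`, the set `O` is the sublevel set `{ρ < 0}`, and the gradient of `ρ` does not vanish. -/
structure IsC1DefiningFunction {d : ℕ} (O : Set (EuclideanSpace ℝ (Fin d)))
    (p : EuclideanSpace ℝ (Fin d)) (U : Set (EuclideanSpace ℝ (Fin d)))
    (ρ : EuclideanSpace ℝ (Fin d) → ℝ) : Prop where
  isOpen : IsOpen U
  mem : p ∈ U
  contDiffOn : ContDiffOn ℝ 1 ρ U
  gradient_ne_zero : ∀ x ∈ U, gradient ρ x ≠ 0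
  inter_eq : O ∩ U = {x ∈ U | ρ x < 0}

/-- The boundary of `O` is of class `C¹`: near each boundary point, `O` lies on one side of a
regular level set of a `C¹` function. -/
def HasC1Boundary {d : ℕ} (O : Set (EuclideanSpace ℝ (Fin d))) : Prop :=
  ∀ p ∈ frontier O, ∃ U ρ, IsC1DefiningFunction O p U ρ

/-- `ν` is the outer unit normal on the boundary of `O`: at each boundary point `p` it is the
normalized gradient of a `C¹` function defining `O` near `p` as `{ρ < 0}`
(the result does not depend on `ρ`). -/
def IsOuterUnitNormal {d : ℕ} (O : Set (EuclideanSpace ℝ (Fin d)))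
    (ν : EuclideanSpace ℝ (Fin d) → EuclideanSpace ℝ (Fin d)) : Prop :=
  ∀ p ∈ frontier O, ∃ U ρ, IsC1DefiningFunction O p U ρ ∧
    ν p = ‖gradient ρ p‖⁻¹ • gradient ρ p

/-- The partial derivative `∂ⱼ bⁱ` at `x`, taken within the set `s`. -/
noncomputable def partialWithin {d : ℕ} (s : Set (EuclideanSpace ℝ (Fin d))) (j i : Fin d)
    (b : EuclideanSpace ℝ (Fin d) → EuclideanSpace ℝ (Fin d))
    (x : EuclideanSpace ℝ (Fin d)) : ℝ :=
  fderivWithin ℝ (fun y => b y i) s x (EuclideanSpace.single j 1)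

/-- The divergence `∑ᵢ ∂ᵢ bⁱ` at `x`, taken within the set `s`. -/
noncomputable def divWithin {d : ℕ} (s : Set (EuclideanSpace ℝ (Fin d)))
    (b : EuclideanSpace ℝ (Fin d) → EuclideanSpace ℝ (Fin d))
    (x : EuclideanSpace ℝ (Fin d)) : ℝ :=
  ∑ i, partialWithin s i i b x

/-- `b` is a Killing vector field on `s`: a `C¹` field with `∂ⱼ bⁱ + ∂ᵢ bʲ = 0` on `s`. -/
def IsKillingOn {d : ℕ} (s : Set (EuclideanSpace ℝ (Fin d)))
    (b : EuclideanSpace ℝ (Fin d) → EuclideanSpace ℝ (Fin d)) : Prop :=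
  ContDiffOn ℝ 1 b s ∧
    ∀ x ∈ s, ∀ i j : Fin d, partialWithin s j i b x + partialWithin s i j b x = 0

/-! Let S be the matrix with entries ∂ⱼbⁱ + ∂ᵢbʲ. Then div S = Δb + ∇ div b, and since S is
symmetric, div(Sb) = ⟨Δb + ∇ div b, b⟩ + |S|²/2. If div b = 0 and ⟨Δb, b⟩ = 0, only |S|²/2 remains
(`divWithin_symGradApply`). The boundary condition says that Sb is tangent to ∂O, so the divergence
theorem gives ∫ |S|² = 0, and S = 0 by continuity. Conversely, if S = 0, its trace gives div b = 0
and its divergence then gives Δb = 0.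

The divergence theorem is needed only for tangent fields F, which avoids surface measure. Near a
boundary point, a test function φ is multiplied by χ(-ρ/ε - 1), with χ the smooth transition, and
integration by parts leaves the layer term ∫ φ (χ'/ε) dρ(F). Tangency gives |dρ(F)| ≤ δ in a thin
layer. The mass of φ χ'/ε is bounded independently of ε by the same identity for a constant inward
field v with dρ(v) ≤ -c. Letting ε and then δ tend to 0 removes the layer term; a partition of unity
globalises. -/

open MeasureTheory Filter Topology Set

/-! ### Defining functions, tangent directions and unique differentiability -/

namespace IsC1DefiningFunction

variable {d : ℕ} {O U : Set (EuclideanSpace ℝ (Fin d))} {p x v : EuclideanSpace ℝ (Fin d)}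
  {ρ : EuclideanSpace ℝ (Fin d) → ℝ}

theorem mem_iff (h : IsC1DefiningFunction O p U ρ) (hx : x ∈ U) : x ∈ O ↔ ρ x < 0 := by
  have := Set.ext_iff.1 h.inter_eq x
  simpa [hx] using this

theorem contDiffAt (h : IsC1DefiningFunction O p U ρ) (hx : x ∈ U) : ContDiffAt ℝ 1 ρ x :=
  h.contDiffOn.contDiffAt (h.isOpen.mem_nhds hx)

theorem nonpos_of_mem_closure (h : IsC1DefiningFunction O p U ρ) (hx : x ∈ U)
    (hxO : x ∈ closure O) : ρ x ≤ 0 := by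
  by_contra! hpos
  have h1 : ∀ᶠ y in 𝓝 x, 0 < ρ y := (h.contDiffAt hx).continuousAt.eventually (lt_mem_nhds hpos)
  obtain ⟨y, hyO, hy, hyU⟩ :=
    ((mem_closure_iff_frequently.1 hxO).and_eventually (h1.and (h.isOpen.mem_nhds hx))).exists
  exact absurd ((h.mem_iff hyU).1 hyO) hy.not_gt

theorem mem_frontier_iff (h : IsC1DefiningFunction O p U ρ) (hO : IsOpen O) (hx : x ∈ U)
    (hxO : x ∈ closure O) : x ∈ frontier O ↔ ρ x = 0 := by
  rw [frontier, hO.interior_eq, Set.mem_sdiff, h.mem_iff hx]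
  have := h.nonpos_of_mem_closure hx hxO
  constructor
  · rintro ⟨-, h2⟩; exact le_antisymm this (not_lt.1 h2)
  · intro h0; exact ⟨hxO, h0.not_lt⟩

/-- The difference quotient of ρ along v is eventually negative, so ρ drops below 0 at once. Both
the tangent cone of the closure and the comparison of two defining functions rest on this. -/
theorem eventually_add_smul_mem (h : IsC1DefiningFunction O p U ρ) (hx : x ∈ U) (h0 : ρ x ≤ 0)
    (hv : fderiv ℝ ρ x v < 0) : ∀ᶠ t : ℝ in 𝓝[>] 0, x + t • v ∈ O := by
  have hd : HasDerivAt (fun t : ℝ => ρ (x + t • v)) (fderiv ℝ ρ x v) 0 :=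
    (((h.contDiffAt hx).differentiableAt one_ne_zero).hasFDerivAt.hasLineDerivAt v)
  have hc : ContinuousAt (fun t : ℝ => x + t • v) 0 := by fun_prop
  have hU : ∀ᶠ t : ℝ in 𝓝[>] 0, x + t • v ∈ U :=
    (hc.eventually_mem (by simpa using h.isOpen.mem_nhds hx)).filter_mono nhdsWithin_le_nhds
  have hs := (hasDerivAt_iff_tendsto_slope.1 hd).eventually (gt_mem_nhds hv)
  have hs' : ∀ᶠ t : ℝ in 𝓝[>] 0, slope (fun t : ℝ => ρ (x + t • v)) 0 t < 0 :=
    hs.filter_mono (nhdsGT_le_nhdsNE 0)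
  filter_upwards [hU, hs', self_mem_nhdsWithin] with t h1 h2 h3
  rw [h.mem_iff h1]
  rw [slope_def_field, div_neg_iff] at h2
  simp only [zero_smul, add_zero, sub_zero] at h2
  have h3 : 0 < t := h3
  rcases h2 with h2 | h2 <;> linarith [h2.1, h2.2]

theorem inner_gradient (ρ : EuclideanSpace ℝ (Fin d) → ℝ) (x v : EuclideanSpace ℝ (Fin d)) :
    inner ℝ (gradient ρ x) v = fderiv ℝ ρ x v := by
  simp [gradient]

theorem fderiv_gradient_pos (h : IsC1DefiningFunction O p U ρ) (hx : x ∈ U) :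
    0 < fderiv ℝ ρ x (gradient ρ x) := by
  rw [← inner_gradient]
  exact real_inner_self_pos.2 (h.gradient_ne_zero x hx)

/-- The tangent spaces of two defining functions at a common boundary point agree. -/
theorem fderiv_eq_zero {q : EuclideanSpace ℝ (Fin d)} {U' : Set (EuclideanSpace ℝ (Fin d))}
    {σ : EuclideanSpace ℝ (Fin d) → ℝ} (h : IsC1DefiningFunction O p U ρ)
    (h' : IsC1DefiningFunction O q U' σ) (hO : IsOpen O) (hx : x ∈ frontier O) (hxU : x ∈ U)
    (hxU' : x ∈ U') (hv : fderiv ℝ ρ x v = 0) : fderiv ℝ σ x v = 0 := by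
  have hxc := frontier_subset_closure hx
  -- Such a w enters O, where σ < 0; since σ x = 0, a positive derivative of σ along w is
  -- impossible.
  have key : ∀ w, fderiv ℝ ρ x w < 0 → fderiv ℝ σ x w ≤ 0 := by
    intro w hw
    have h1 := h.eventually_add_smul_mem hxU (h.nonpos_of_mem_closure hxU hxc) hw
    by_contra! h2
    have hd : HasDerivAt (fun t : ℝ => σ (x + t • w)) (fderiv ℝ σ x w) 0 :=
      (((h'.contDiffAt hxU').differentiableAt one_ne_zero).hasFDerivAt.hasLineDerivAt w)
    have hs := ((hasDerivAt_iff_tendsto_slope.1 hd).eventually (lt_mem_nhds h2)).filter_mono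
      (nhdsGT_le_nhdsNE 0)
    have hc : ContinuousAt (fun t : ℝ => x + t • w) 0 := by fun_prop
    have hU : ∀ᶠ t : ℝ in 𝓝[>] 0, x + t • w ∈ U' :=
      (hc.eventually_mem (by simpa using h'.isOpen.mem_nhds hxU')).filter_mono nhdsWithin_le_nhds
    obtain ⟨t, ht1, ht2, ht3, ht4⟩ :=
      (h1.and (hs.and (hU.and (self_mem_nhdsWithin : Ioi (0 : ℝ) ∈ 𝓝[>] 0)))).exists
    have h0 : σ x = 0 := (h'.mem_frontier_iff hO hxU' hxc).1 hx
    rw [h'.mem_iff ht3] at ht1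
    rw [slope_def_field, div_pos_iff] at ht2
    simp only [zero_smul, add_zero, sub_zero, h0] at ht2
    have ht4 : 0 < t := ht4
    rcases ht2 with ht2 | ht2 <;> linarith [ht2.1, ht2.2]
  -- A tangent w is the limit of the strictly descending directions w - s • n as s ↓ 0. Using ±v
  -- then gives equality.
  have key2 : ∀ w, fderiv ℝ ρ x w = 0 → fderiv ℝ σ x w ≤ 0 := by
    intro w hw
    set n := gradient ρ x
    have hn := h.fderiv_gradient_pos hxU
    have hlim : Tendsto (fun s : ℝ => fderiv ℝ σ x (w - s • n)) (𝓝[>] 0)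
        (𝓝 (fderiv ℝ σ x (w - (0 : ℝ) • n))) := by
      refine Tendsto.mono_left (Continuous.tendsto ?_ 0) nhdsWithin_le_nhds
      fun_prop
    rw [zero_smul, sub_zero] at hlim
    refine le_of_tendsto hlim ?_
    filter_upwards [self_mem_nhdsWithin] with s hs
    apply key
    have hs : 0 < s := hs
    simp only [map_sub, map_smul, smul_eq_mul, hw]
    have := mul_pos hs hn
    linarith
  refine le_antisymm (key2 v hv) ?_
  have := key2 (-v) (by simp [hv])
  simpa using this

end IsC1DefiningFunction

/-- At a boundary point the tangent cone contains the open half-space dρ < 0, which spans the whole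
space. -/
theorem HasC1Boundary.uniqueDiffOn_closure {d : ℕ} {O : Set (EuclideanSpace ℝ (Fin d))}
    (hO : IsOpen O) (hC1 : HasC1Boundary O) : UniqueDiffOn ℝ (closure O) := by
  intro x hx
  by_cases hxO : x ∈ O
  · exact (hO.uniqueDiffWithinAt hxO).mono subset_closure
  have hxf : x ∈ frontier O := by rw [frontier, hO.interior_eq]; exact ⟨hx, hxO⟩
  obtain ⟨U, ρ, h⟩ := hC1 x hxf
  have hcone : ∀ w, fderiv ℝ ρ x w < 0 → w ∈ tangentConeAt ℝ (closure O) x := by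
    intro w hw
    refine mem_tangentConeAt_of_add_smul_mem (l := 𝓝[>] (0 : ℝ)) (c := id)
      (tendsto_id'.2 (nhdsGT_le_nhdsNE 0)) ?_
    filter_upwards [h.eventually_add_smul_mem h.mem (h.nonpos_of_mem_closure h.mem hx) hw] with t ht
    exact subset_closure ht
  refine ⟨?_, subset_closure hx⟩
  have htop : Submodule.span ℝ (tangentConeAt ℝ (closure O) x) = ⊤ := by
    rw [eq_top_iff]
    intro w _
    set n := gradient ρ x
    have hn : 0 < fderiv ℝ ρ x n := h.fderiv_gradient_pos h.mem
    -- Chosen so that dρ(w - s • n) = dρ(w) - |dρ(w)| - 1 < 0; thus w is a combination of two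
    -- descending directions.
    set s := (|fderiv ℝ ρ x w| + 1) / fderiv ℝ ρ x n
    have hs : 0 < s := by positivity
    have e : w = (w - s • n) - s • (-n) := by module
    rw [e]
    refine Submodule.sub_mem _ (Submodule.subset_span (hcone _ ?_))
      (Submodule.smul_mem _ _ (Submodule.subset_span (hcone _ ?_)))
    · have : s * fderiv ℝ ρ x n = |fderiv ℝ ρ x w| + 1 := div_mul_cancel₀ _ hn.ne'
      simp only [map_sub, map_smul, smul_eq_mul, this]
      linarith [le_abs_self (fderiv ℝ ρ x w)]
    · simpa using hn
  rw [htop]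
  exact dense_univ

/-! ### Integration by parts against test functions -/

theorem contDiff_mul_of_tsupport_subset {E : Type*} [NormedAddCommGroup E] [NormedSpace ℝ E]
    {O : Set E} (hO : IsOpen O) {ζ f : E → ℝ} (hζ : ContDiff ℝ 1 ζ) (hs : tsupport ζ ⊆ O)
    (hf : ContDiffOn ℝ 1 f O) : ContDiff ℝ 1 (fun x => ζ x * f x) := by
  rw [contDiff_iff_contDiffAt]
  intro x
  by_cases hx : x ∈ tsupport ζ
  · exact hζ.contDiffAt.mul (hf.contDiffAt (hO.mem_nhds (hs hx)))
  · refine (contDiffAt_const (c := (0 : ℝ))).congr_of_eventuallyEq ?_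
    filter_upwards [notMem_tsupport_iff_eventuallyEq.1 hx] with y hy
    simp [hy]

theorem integral_fderiv_apply_eq_zero {d : ℕ} {f : EuclideanSpace ℝ (Fin d) → ℝ}
    (hf : ContDiff ℝ 1 f) (hc : HasCompactSupport f) (v : EuclideanSpace ℝ (Fin d)) :
    Integrable (fun x => fderiv ℝ f x v) ∧ ∫ x, fderiv ℝ f x v = 0 := by
  have hi : Integrable (fun x => fderiv ℝ f x v) :=
    ((hf.continuous_fderiv one_ne_zero).clm_apply continuous_const).integrable_of_hasCompactSupport
      (hc.fderiv_apply (𝕜 := ℝ) v)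
  have hfi : Integrable f := hf.continuous.integrable_of_hasCompactSupport hc
  refine ⟨hi, ?_⟩
  -- Integration by parts against the constant function 1.
  have := integral_bilinear_hasFDerivAt_right_eq_neg_left_of_integrable (μ := volume)
    (f := fun _ : EuclideanSpace ℝ (Fin d) => (1 : ℝ)) (f' := fun _ => 0) (g := f)
    (g' := fderiv ℝ f) (v := v) (B := ContinuousLinearMap.mul ℝ ℝ)
    (by simp) (by simpa using hi) (by simpa using hfi) (fun x _ => hasFDerivAt_const 1 x)
    (fun x _ => (hf.differentiable one_ne_zero x).hasFDerivAt)
  simpa using this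

theorem sum_apply_mul_single {d : ℕ} (L : EuclideanSpace ℝ (Fin d) →L[ℝ] ℝ)
    (w : EuclideanSpace ℝ (Fin d)) : ∑ i, w i * L (EuclideanSpace.single i 1) = L w := by
  conv_rhs => rw [← (EuclideanSpace.basisFun (Fin d) ℝ).sum_repr w]
  simp

/-- Integration by parts against a test function: `∫ (dζ(F) + ζ div F) = 0`. -/
theorem integral_fderiv_apply_add_mul_div {d : ℕ} {O : Set (EuclideanSpace ℝ (Fin d))}
    (hO : IsOpen O) {ζ : EuclideanSpace ℝ (Fin d) → ℝ} (hζ : ContDiff ℝ 1 ζ)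
    (hc : HasCompactSupport ζ) (hs : tsupport ζ ⊆ O)
    {F : EuclideanSpace ℝ (Fin d) → EuclideanSpace ℝ (Fin d)} (hF : ContDiffOn ℝ 1 F O) :
    Integrable (fun x => fderiv ℝ ζ x (F x)
      + ζ x * ∑ i, fderiv ℝ (fun y => F y i) x (EuclideanSpace.single i 1)) ∧
    ∫ x, (fderiv ℝ ζ x (F x)
      + ζ x * ∑ i, fderiv ℝ (fun y => F y i) x (EuclideanSpace.single i 1)) = 0 := by
  have hFi : ∀ i, ContDiffOn ℝ 1 (fun y => F y i) O := contDiffOn_euclidean.1 hF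
  have hp : ∀ i, ContDiff ℝ 1 (fun x => ζ x * F x i) := fun i =>
    contDiff_mul_of_tsupport_subset hO hζ hs (hFi i)
  have key := fun i => integral_fderiv_apply_eq_zero (hp i) hc.mul_right
    (EuclideanSpace.single i 1)
  have e : (fun x => fderiv ℝ ζ x (F x)
      + ζ x * ∑ i, fderiv ℝ (fun y => F y i) x (EuclideanSpace.single i 1)) =
      fun x => ∑ i, fderiv ℝ (fun x => ζ x * F x i) x (EuclideanSpace.single i 1) := by
    ext x
    rw [← sum_apply_mul_single, Finset.mul_sum, ← Finset.sum_add_distrib]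
    refine Finset.sum_congr rfl fun i _ => ?_
    by_cases hx : x ∈ tsupport ζ
    · rw [fderiv_fun_mul (hζ.differentiable one_ne_zero x)
        (((hFi i).contDiffAt (hO.mem_nhds (hs hx))).differentiableAt one_ne_zero)]
      simp only [_root_.add_apply, _root_.smul_apply, smul_eq_mul]
      ring
    · have h0 := notMem_tsupport_iff_eventuallyEq.1 hx
      have h1 : (fun x => ζ x * F x i) =ᶠ[𝓝 x] fun _ => 0 := by
        filter_upwards [h0] with y hy
        simp [hy]
      have h0' : ζ =ᶠ[𝓝 x] fun _ => 0 := h0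
      rw [h1.fderiv_eq, h0'.fderiv_eq, h0'.eq_of_nhds]
      simp
  rw [e]
  exact ⟨integrable_finsetSum _ fun i _ => (key i).1, by
    rw [integral_finsetSum _ fun i _ => (key i).1]
    exact Finset.sum_eq_zero fun i _ => (key i).2⟩

/-! ### Cutting off near the boundary -/

theorem Real.deriv_smoothTransition_nonneg (t : ℝ) : 0 ≤ deriv Real.smoothTransition t :=
  Real.smoothTransition.monotone.deriv_nonneg

/-- With t = -ρ/ε - 1 this confines the derivative of the cutoff factor to the layer -ρ ≤ 2ε. -/
theorem Real.le_one_of_deriv_smoothTransition_ne_zero {t : ℝ}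
    (h : deriv Real.smoothTransition t ≠ 0) : t ≤ 1 := by
  by_contra! ht
  apply h
  have : Real.smoothTransition =ᶠ[𝓝 t] fun _ => 1 := by
    filter_upwards [lt_mem_nhds ht] with y hy
    exact Real.smoothTransition.one_of_one_le hy.le
  rw [this.deriv_eq]
  simp

section Cutoff

variable {d : ℕ} {O U : Set (EuclideanSpace ℝ (Fin d))} {p : EuclideanSpace ℝ (Fin d)}
  {ρ φ : EuclideanSpace ℝ (Fin d) → ℝ} {ε : ℝ}

/-- The function `φ` cut off near the boundary of `O`: it vanishes where `ρ ≥ -ε` and equals `φ`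
where `ρ ≤ -2ε`. -/
noncomputable def boundaryCutoff (O : Set (EuclideanSpace ℝ (Fin d)))
    (ρ φ : EuclideanSpace ℝ (Fin d) → ℝ) (ε : ℝ) : EuclideanSpace ℝ (Fin d) → ℝ :=
  O.indicator fun x => φ x * Real.smoothTransition (-ρ x / ε - 1)

theorem boundaryCutoff_eventuallyEq_zero (h : IsC1DefiningFunction O p U ρ) (hε : 0 < ε)
    (hs : tsupport φ ⊆ U) {x : EuclideanSpace ℝ (Fin d)} (hx : x ∈ tsupport φ → -ε < ρ x) :
    boundaryCutoff O ρ φ ε =ᶠ[𝓝 x] fun _ => 0 := by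
  by_cases hxs : x ∈ tsupport φ
  · filter_upwards [(h.contDiffAt (hs hxs)).continuousAt.eventually (lt_mem_nhds (hx hxs))]
      with y hy
    have : -ρ y / ε - 1 ≤ 0 := by
      rw [sub_nonpos, div_le_one hε]; linarith
    simp [boundaryCutoff, Set.indicator, Real.smoothTransition.zero_of_nonpos this]
  · filter_upwards [notMem_tsupport_iff_eventuallyEq.1 hxs] with y hy
    simp [boundaryCutoff, Set.indicator, hy]

/-- A point of `tsupport φ` outside O has ρ ≥ 0 > -ε, so the cutoff vanishes on a whole
neighbourhood of it; this gap is the purpose of the shift by -1. -/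
theorem tsupport_boundaryCutoff_subset (h : IsC1DefiningFunction O p U ρ) (hε : 0 < ε)
    (hs : tsupport φ ⊆ U) : tsupport (boundaryCutoff O ρ φ ε) ⊆ O := by
  intro x hx
  by_contra hxO
  refine notMem_tsupport_iff_eventuallyEq.2
    (boundaryCutoff_eventuallyEq_zero h hε hs fun hxs => ?_) hx
  rw [h.mem_iff (hs hxs)] at hxO
  linarith

theorem contDiffAt_smoothTransition_comp (h : IsC1DefiningFunction O p U ρ)
    {x : EuclideanSpace ℝ (Fin d)} (hx : x ∈ U) :
    ContDiffAt ℝ 1 (fun x => Real.smoothTransition (-ρ x / ε - 1)) x :=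
  (Real.smoothTransition.contDiffAt (n := 1)).comp x
    (((h.contDiffAt hx).neg.div_const ε).sub contDiffAt_const)

theorem contDiff_boundaryCutoff (h : IsC1DefiningFunction O p U ρ) (hO : IsOpen O) (hε : 0 < ε)
    (hφ : ContDiff ℝ 1 φ) (hs : tsupport φ ⊆ U) : ContDiff ℝ 1 (boundaryCutoff O ρ φ ε) := by
  rw [contDiff_iff_contDiffAt]
  intro x
  by_cases hx : x ∈ tsupport φ → -ε < ρ x
  · exact contDiffAt_const.congr_of_eventuallyEq (boundaryCutoff_eventuallyEq_zero h hε hs hx)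
  · push Not at hx
    have hxO : x ∈ O := (h.mem_iff (hs hx.1)).2 (by linarith [hx.2])
    refine (hφ.contDiffAt.mul (contDiffAt_smoothTransition_comp (ε := ε) h
      (hs hx.1))).congr_of_eventuallyEq ?_
    filter_upwards [hO.mem_nhds hxO] with y hy
    simp [boundaryCutoff, hy]

theorem hasCompactSupport_boundaryCutoff (hc : HasCompactSupport φ) :
    HasCompactSupport (boundaryCutoff O ρ φ ε) := by
  refine hc.mono fun x hx => ?_
  rw [Function.mem_support] at hx ⊢
  contrapose! hx
  simp [boundaryCutoff, Set.indicator, hx]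

theorem fderiv_boundaryCutoff (h : IsC1DefiningFunction O p U ρ) (hO : IsOpen O)
    (hφ : ContDiff ℝ 1 φ) {x : EuclideanSpace ℝ (Fin d)} (hx : x ∈ O) (hxU : x ∈ U)
    (w : EuclideanSpace ℝ (Fin d)) :
    fderiv ℝ (boundaryCutoff O ρ φ ε) x w =
      Real.smoothTransition (-ρ x / ε - 1) * fderiv ℝ φ x w
        - φ x * (deriv Real.smoothTransition (-ρ x / ε - 1) / ε) * fderiv ℝ ρ x w := by
  have e : boundaryCutoff O ρ φ ε =ᶠ[𝓝 x]
      fun x => φ x * Real.smoothTransition (-ρ x / ε - 1) := by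
    filter_upwards [hO.mem_nhds hx] with y hy
    simp [boundaryCutoff, hy]
  have h1 := (hφ.differentiable one_ne_zero x).hasFDerivAt
  have h2 := ((h.contDiffAt hxU).differentiableAt one_ne_zero).hasFDerivAt
  have h3 : HasFDerivAt (fun x => -ρ x / ε - 1) (ε⁻¹ • -fderiv ℝ ρ x) x := by
    simp only [div_eq_inv_mul]
    exact (h2.neg.const_mul ε⁻¹).sub_const 1
  have h4 : HasDerivAt Real.smoothTransition (deriv Real.smoothTransition (-ρ x / ε - 1))
      (-ρ x / ε - 1) :=
    ((Real.smoothTransition.contDiffAt (n := 1)).differentiableAt one_ne_zero).hasDerivAt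
  have h5 := h4.comp_hasFDerivAt x h3
  simp only [Function.comp_def] at h5
  rw [e.fderiv_eq, (h1.fun_mul h5).fderiv]
  simp only [_root_.add_apply, _root_.smul_apply, _root_.neg_apply, smul_eq_mul]
  ring

end Cutoff

/-! ### Divergence theorem for tangent fields near a boundary point -/

theorem partialWithin_eq_fderiv {d : ℕ} {s : Set (EuclideanSpace ℝ (Fin d))}
    {b : EuclideanSpace ℝ (Fin d) → EuclideanSpace ℝ (Fin d)} {x : EuclideanSpace ℝ (Fin d)}
    (hs : s ∈ 𝓝 x) (j i : Fin d) :
    partialWithin s j i b x = fderiv ℝ (fun y => b y i) x (EuclideanSpace.single j 1) := by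
  rw [partialWithin, fderivWithin_of_mem_nhds hs]

theorem ContDiffOn.continuousOn_partialWithin {d : ℕ} {s : Set (EuclideanSpace ℝ (Fin d))}
    (hs : UniqueDiffOn ℝ s) {b : EuclideanSpace ℝ (Fin d) → EuclideanSpace ℝ (Fin d)}
    (hb : ContDiffOn ℝ 1 b s) (j i : Fin d) : ContinuousOn (partialWithin s j i b) s :=
  ((contDiffOn_euclidean.1 hb i).continuousOn_fderivWithin hs le_rfl).clm_apply continuousOn_const

theorem ContDiffOn.continuousOn_divWithin {d : ℕ} {s : Set (EuclideanSpace ℝ (Fin d))}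
    (hs : UniqueDiffOn ℝ s) {b : EuclideanSpace ℝ (Fin d) → EuclideanSpace ℝ (Fin d)}
    (hb : ContDiffOn ℝ 1 b s) : ContinuousOn (divWithin s b) s :=
  continuousOn_finsetSum _ fun i _ => hb.continuousOn_partialWithin hs i i

/-- Applied with g the layer term, this spares a separate proof that the layer term is integrable.
-/
theorem integral_eq_of_integral_sub_eq_zero {α : Type*} [MeasurableSpace α] {μ : Measure α}
    {f g : α → ℝ} (hf : Integrable f μ) (hfg : Integrable (fun x => f x - g x) μ)
    (h0 : ∫ x, (f x - g x) ∂μ = 0) : Integrable g μ ∧ ∫ x, f x ∂μ = ∫ x, g x ∂μ := by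
  have hg : Integrable g μ := by
    refine (hf.sub hfg).congr (Eventually.of_forall fun x => ?_)
    simp
  exact ⟨hg, by rwa [integral_sub hf hg, sub_eq_zero] at h0⟩

section Local

variable {d : ℕ} {O U : Set (EuclideanSpace ℝ (Fin d))} {p v : EuclideanSpace ℝ (Fin d)}
  {ρ φ : EuclideanSpace ℝ (Fin d) → ℝ} {c : ℝ}
  {F : EuclideanSpace ℝ (Fin d) → EuclideanSpace ℝ (Fin d)}

/-- The flux of a field tangent to the boundary is uniformly small near the boundary. -/
theorem exists_abs_fderiv_le_of_tangent (h : IsC1DefiningFunction O p U ρ) (hO : IsOpen O)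
    (hF : ContinuousOn F (closure O))
    (htan : ∀ x ∈ frontier O, x ∈ U → fderiv ℝ ρ x (F x) = 0)
    {K : Set (EuclideanSpace ℝ (Fin d))} (hK : IsCompact K) (hKU : K ⊆ U) {δ : ℝ} (hδ : 0 < δ) :
    ∃ ε₀ > 0, ∀ x ∈ K, x ∈ O → -ρ x < ε₀ → |fderiv ℝ ρ x (F x)| ≤ δ := by
  have hρ1 : ContinuousOn (fderiv ℝ ρ) U :=
    h.contDiffOn.continuousOn_fderiv_of_isOpen h.isOpen le_rfl
  have hC : IsCompact (K ∩ closure O) := hK.inter_right isClosed_closure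
  have hg : ContinuousOn (fun x => |fderiv ℝ ρ x (F x)|) (K ∩ closure O) :=
    ((hρ1.mono (inter_subset_left.trans hKU)).clm_apply (hF.mono inter_subset_right)).abs
  have hT : IsCompact ((K ∩ closure O) ∩ (fun x => |fderiv ℝ ρ x (F x)|) ⁻¹' Ici δ) :=
    hC.of_isClosed_subset (hg.preimage_isClosed_of_isClosed hC.isClosed isClosed_Ici)
      inter_subset_left
  rcases eq_empty_or_nonempty
    ((K ∩ closure O) ∩ (fun x => |fderiv ℝ ρ x (F x)|) ⁻¹' Ici δ) with he | hne
  · refine ⟨1, one_pos, fun x hxK hxO _ => ?_⟩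
    by_contra! hlt
    have : x ∈ (∅ : Set (EuclideanSpace ℝ (Fin d))) :=
      he ▸ ⟨⟨hxK, subset_closure hxO⟩, hlt.le⟩
    exact this
  -- On the compact set where the flux is at least δ, ρ attains a maximum. It is negative, as the
  -- flux vanishes where ρ = 0, so its negative serves as ε₀.
  · obtain ⟨y, ⟨⟨hyK, hyO⟩, hyδ⟩, hy⟩ := hT.exists_isMaxOn hne
      (h.contDiffOn.continuousOn.mono fun x hx => hKU hx.1.1)
    have hyδ : δ ≤ |fderiv ℝ ρ y (F y)| := hyδ
    have hneg : ρ y < 0 := by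
      refine lt_of_le_of_ne (h.nonpos_of_mem_closure (hKU hyK) hyO) fun h0 => ?_
      rw [htan y ((h.mem_frontier_iff hO (hKU hyK) hyO).2 h0) (hKU hyK), abs_zero] at hyδ
      linarith
    refine ⟨-ρ y, by linarith, fun x hxK hxO hx => ?_⟩
    by_contra! hlt
    have : ρ x ≤ ρ y := hy ⟨⟨hxK, subset_closure hxO⟩, hlt.le⟩
    linarith

/-- Integration by parts with `boundaryCutoff` as test function, its differential expanded. The
subtracted term is a flux smeared over the layer ε ≤ -ρ ≤ 2ε. -/
theorem boundaryCutoff_integral_eq (h : IsC1DefiningFunction O p U ρ) (hO : IsOpen O)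
    (hF : ContDiffOn ℝ 1 F O) (hφ : ContDiff ℝ 1 φ) (hc : HasCompactSupport φ)
    (hs : tsupport φ ⊆ U) {ε : ℝ} (hε : 0 < ε) :
    IntegrableOn (fun x => Real.smoothTransition (-ρ x / ε - 1) * (fderiv ℝ φ x (F x)
        + φ x * divWithin (closure O) F x)
      - φ x * (deriv Real.smoothTransition (-ρ x / ε - 1) / ε) * fderiv ℝ ρ x (F x)) (O ∩ U) ∧
    ∫ x in O ∩ U, (Real.smoothTransition (-ρ x / ε - 1) * (fderiv ℝ φ x (F x)
        + φ x * divWithin (closure O) F x)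
      - φ x * (deriv Real.smoothTransition (-ρ x / ε - 1) / ε) * fderiv ℝ ρ x (F x)) = 0 := by
  obtain ⟨h1, h2⟩ := integral_fderiv_apply_add_mul_div hO (contDiff_boundaryCutoff h hO hε hφ hs)
    (hasCompactSupport_boundaryCutoff hc) (tsupport_boundaryCutoff_subset h hε hs) hF
  have hOU : IsOpen (O ∩ U) := hO.inter h.isOpen
  have e : EqOn (fun x => fderiv ℝ (boundaryCutoff O ρ φ ε) x (F x)
      + boundaryCutoff O ρ φ ε x * ∑ i, fderiv ℝ (fun y => F y i) x (EuclideanSpace.single i 1))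
      (fun x => Real.smoothTransition (-ρ x / ε - 1) * (fderiv ℝ φ x (F x)
        + φ x * divWithin (closure O) F x)
      - φ x * (deriv Real.smoothTransition (-ρ x / ε - 1) / ε) * fderiv ℝ ρ x (F x))
      (O ∩ U) := by
    intro x hx
    have hn : closure O ∈ 𝓝 x := mem_of_superset (hO.mem_nhds hx.1) subset_closure
    simp only [divWithin, partialWithin_eq_fderiv hn]
    rw [fderiv_boundaryCutoff h hO hφ hx.1 hx.2, boundaryCutoff, indicator_of_mem hx.1]
    ring
  refine ⟨h1.integrableOn.congr_fun e hOU.measurableSet, ?_⟩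
  rw [← setIntegral_congr_fun hOU.measurableSet e, ← h2]
  refine setIntegral_eq_integral_of_forall_compl_eq_zero fun x hx => ?_
  have h0 : boundaryCutoff O ρ φ ε =ᶠ[𝓝 x] fun _ => 0 := by
    by_cases hxU : x ∈ U
    · refine boundaryCutoff_eventuallyEq_zero h hε hs fun _ => ?_
      have : x ∉ O := fun hxO => hx ⟨hxO, hxU⟩
      rw [h.mem_iff hxU] at this
      linarith
    · exact boundaryCutoff_eventuallyEq_zero h hε hs fun hxs => absurd (hs hxs) hxU
  rw [h0.fderiv_eq, h0.eq_of_nhds]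
  simp

theorem norm_smoothTransition_mul_le (t a : ℝ) : ‖Real.smoothTransition t * a‖ ≤ ‖a‖ := by
  rw [norm_mul, Real.norm_of_nonneg (Real.smoothTransition.nonneg t)]
  exact mul_le_of_le_one_left (norm_nonneg a) (Real.smoothTransition.le_one t)

theorem integrableOn_smoothTransition_mul (h : IsC1DefiningFunction O p U ρ) (hO : IsOpen O)
    {ε : ℝ} {G : EuclideanSpace ℝ (Fin d) → ℝ} (hG : IntegrableOn G (O ∩ U)) :
    IntegrableOn (fun x => Real.smoothTransition (-ρ x / ε - 1) * G x) (O ∩ U) := by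
  refine Integrable.mono hG (AEStronglyMeasurable.mul ?_ hG.aestronglyMeasurable)
    (Eventually.of_forall fun x => norm_smoothTransition_mul_le _ _)
  refine ContinuousOn.aestronglyMeasurable (fun x hx => ?_) (hO.inter h.isOpen).measurableSet
  exact (contDiffAt_smoothTransition_comp h hx.2).continuousAt.continuousWithinAt

/-- The part of the integral which the cutoff leaves over is controlled by the smallness of
the flux near the boundary. -/
theorem abs_integral_smoothTransition_mul_le (h : IsC1DefiningFunction O p U ρ) (hO : IsOpen O)
    (hF : ContDiffOn ℝ 1 F O) (hφ : ContDiff ℝ 1 φ) (hc : HasCompactSupport φ)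
    (hs : tsupport φ ⊆ U) (hφ0 : ∀ x, 0 ≤ φ x)
    (hG : IntegrableOn (fun x => fderiv ℝ φ x (F x) + φ x * divWithin (closure O) F x) (O ∩ U))
    (hc0 : 0 < c) (hv : ∀ x ∈ U, fderiv ℝ ρ x v ≤ -c) {ε δ : ℝ} (hε : 0 < ε) (hδ : 0 ≤ δ)
    (hflux : ∀ x ∈ tsupport φ, x ∈ O → -ρ x ≤ 2 * ε → |fderiv ℝ ρ x (F x)| ≤ δ) :
    |∫ x in O ∩ U, Real.smoothTransition (-ρ x / ε - 1) *
      (fderiv ℝ φ x (F x) + φ x * divWithin (closure O) F x)|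
      ≤ δ / c * ∫ x in O ∩ U, |fderiv ℝ φ x v| := by
  have hOU : IsOpen (O ∩ U) := hO.inter h.isOpen
  obtain ⟨hF1, hF2⟩ := boundaryCutoff_integral_eq h hO hF hφ hc hs hε
  -- The divergence-free constant field v measures the mass of the layer.
  obtain ⟨hv1, hv2⟩ := boundaryCutoff_integral_eq h hO (F := fun _ => v) contDiffOn_const hφ hc
    hs hε
  have hdiv : ∀ x, divWithin (closure O) (fun _ => v) x = 0 := fun x => by
    simp [divWithin, partialWithin]
  simp only [hdiv, mul_zero, add_zero] at hv1 hv2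
  have hφv : IntegrableOn (fun x => fderiv ℝ φ x v) (O ∩ U) :=
    (integral_fderiv_apply_eq_zero hφ hc v).1.integrableOn
  have hGm := integrableOn_smoothTransition_mul (ε := ε) h hO hG
  have hvm := integrableOn_smoothTransition_mul (ε := ε) h hO hφv
  obtain ⟨hB, eB⟩ := integral_eq_of_integral_sub_eq_zero hGm hF1 hF2
  obtain ⟨hD, eD⟩ := integral_eq_of_integral_sub_eq_zero hvm hv1 hv2
  -- Where the weight is nonzero, |dρ(F)| ≤ δ ≤ (δ/c)(-dρ(v)).
  have hpt : ∀ x ∈ O ∩ U,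
      |φ x * (deriv Real.smoothTransition (-ρ x / ε - 1) / ε) * fderiv ℝ ρ x (F x)| ≤
        δ / c * -(φ x * (deriv Real.smoothTransition (-ρ x / ε - 1) / ε) * fderiv ℝ ρ x v) := by
    intro x hx
    have hH : 0 ≤ φ x * (deriv Real.smoothTransition (-ρ x / ε - 1) / ε) :=
      mul_nonneg (hφ0 x) (div_nonneg (Real.deriv_smoothTransition_nonneg _) hε.le)
    rcases hH.eq_or_lt with h0 | hpos
    · simp [← h0]
    · have hxs : x ∈ tsupport φ := subset_tsupport _ fun h0 => by simp [h0] at hpos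
      have h1 := Real.le_one_of_deriv_smoothTransition_ne_zero (t := -ρ x / ε - 1)
        fun h0 => by simp [h0] at hpos
      have h2 : -ρ x ≤ 2 * ε := by
        rw [← div_le_iff₀ hε]; linarith
      have h3 : δ ≤ δ / c * -fderiv ℝ ρ x v := by
        rw [div_mul_eq_mul_div, le_div_iff₀ hc0]
        exact mul_le_mul_of_nonneg_left (by linarith [hv x hx.2]) hδ
      rw [abs_mul, abs_of_pos hpos]
      calc _ ≤ φ x * (deriv Real.smoothTransition (-ρ x / ε - 1) / ε) *
            (δ / c * -fderiv ℝ ρ x v) :=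
            mul_le_mul_of_nonneg_left ((hflux x hxs hx.1 h2).trans h3) hH
        _ = _ := by ring
  rw [eB]
  calc _ ≤ ∫ x in O ∩ U,
        |φ x * (deriv Real.smoothTransition (-ρ x / ε - 1) / ε) * fderiv ℝ ρ x (F x)| :=
        abs_integral_le_integral_abs
    _ ≤ ∫ x in O ∩ U, δ / c *
        -(φ x * (deriv Real.smoothTransition (-ρ x / ε - 1) / ε) * fderiv ℝ ρ x v) :=
        setIntegral_mono_on hB.abs (hD.neg.const_mul _) hOU.measurableSet hpt
    _ = δ / c * ∫ x in O ∩ U, -(Real.smoothTransition (-ρ x / ε - 1) * fderiv ℝ φ x v) := by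
        rw [integral_const_mul, integral_neg, integral_neg, eD]
    _ ≤ _ := by
        refine mul_le_mul_of_nonneg_left ?_ (by positivity)
        refine integral_mono hvm.neg hφv.abs fun x => ?_
        exact (neg_le_abs _).trans (norm_smoothTransition_mul_le _ _)

/-- Dominated convergence: at a fixed x in O ∩ U the factor equals 1 once ε < -ρ x / 2. -/
theorem tendsto_integral_smoothTransition_mul (h : IsC1DefiningFunction O p U ρ) (hO : IsOpen O)
    {G : EuclideanSpace ℝ (Fin d) → ℝ} (hG : IntegrableOn G (O ∩ U)) :
    Tendsto (fun ε => ∫ x in O ∩ U, Real.smoothTransition (-ρ x / ε - 1) * G x) (𝓝[>] 0)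
      (𝓝 (∫ x in O ∩ U, G x)) := by
  have hOU : IsOpen (O ∩ U) := hO.inter h.isOpen
  refine tendsto_integral_filter_of_dominated_convergence (fun x => ‖G x‖)
    (Eventually.of_forall fun ε =>
      (integrableOn_smoothTransition_mul (ε := ε) h hO hG).aestronglyMeasurable)
    (Eventually.of_forall fun ε => Eventually.of_forall fun x =>
      norm_smoothTransition_mul_le _ _) hG.norm ?_
  refine (ae_restrict_iff' hOU.measurableSet).2 (Eventually.of_forall fun x hx => ?_)
  have hρ : ρ x < 0 := (h.mem_iff hx.2).1 hx.1
  refine tendsto_const_nhds.congr' ?_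
  filter_upwards [Ioo_mem_nhdsGT (show (0 : ℝ) < -ρ x / 2 by linarith)] with ε hε
  have h1 : 1 ≤ -ρ x / ε - 1 := by
    have : 2 ≤ -ρ x / ε := by rw [le_div_iff₀ hε.1]; linarith [hε.2]
    linarith
  rw [Real.smoothTransition.one_of_one_le h1, one_mul]

/-- The divergence theorem for a field tangent to the boundary, multiplied by a test function
supported near a boundary point. -/
theorem setIntegral_fderiv_apply_add_mul_divWithin_of_tangent (h : IsC1DefiningFunction O p U ρ)
    (hO : IsOpen O) (hF : ContDiffOn ℝ 1 F (closure O))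
    (htan : ∀ x ∈ frontier O, x ∈ U → fderiv ℝ ρ x (F x) = 0)
    (hφ : ContDiff ℝ 1 φ) (hc : HasCompactSupport φ)
    (hs : tsupport φ ⊆ U) (hφ0 : ∀ x, 0 ≤ φ x)
    (hG : IntegrableOn (fun x => fderiv ℝ φ x (F x) + φ x * divWithin (closure O) F x) O)
    (hc0 : 0 < c) (hv : ∀ x ∈ U, fderiv ℝ ρ x v ≤ -c) :
    ∫ x in O, (fderiv ℝ φ x (F x) + φ x * divWithin (closure O) F x) = 0 := by
  have hG' := hG.mono_set (inter_subset_left (t := U))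
  have hzero : ∀ x ∈ O \ (O ∩ U), fderiv ℝ φ x (F x) + φ x * divWithin (closure O) F x = 0 := by
    intro x hx
    have hxs : x ∉ tsupport φ := fun hxs => hx.2 ⟨hx.1, hs hxs⟩
    have h0 : φ =ᶠ[𝓝 x] fun _ => 0 := notMem_tsupport_iff_eventuallyEq.1 hxs
    rw [h0.fderiv_eq, h0.eq_of_nhds]
    simp
  rw [setIntegral_eq_of_subset_of_forall_sdiff_eq_zero hO.measurableSet inter_subset_left hzero]
  set I := ∫ x in O ∩ U, (fderiv ℝ φ x (F x) + φ x * divWithin (closure O) F x)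
  set C := ∫ x in O ∩ U, |fderiv ℝ φ x v|
  -- Here ε tends to 0 with δ fixed; C does not depend on either, so δ can tend to 0 afterwards.
  have hbound : ∀ δ > 0, |I| ≤ δ / c * C := by
    intro δ hδ
    obtain ⟨ε₀, hε₀, hflux⟩ := exists_abs_fderiv_le_of_tangent h hO hF.continuousOn htan hc hs hδ
    refine le_of_tendsto (tendsto_integral_smoothTransition_mul h hO hG').abs ?_
    filter_upwards [Ioo_mem_nhdsGT (show (0 : ℝ) < ε₀ / 2 by linarith)] with ε hε
    exact abs_integral_smoothTransition_mul_le h hO (hF.mono subset_closure) hφ hc hs hφ0 hG' hc0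
      hv hε.1 hδ.le fun x hx hxO hxε => hflux x hx hxO (by linarith [hε.2])
  have hlim : Tendsto (fun δ : ℝ => δ / c * C) (𝓝[>] 0) (𝓝 (0 / c * C)) :=
    Tendsto.mono_left (Continuous.tendsto (by fun_prop) 0) nhdsWithin_le_nhds
  have : |I| ≤ 0 / c * C :=
    ge_of_tendsto hlim (by filter_upwards [self_mem_nhdsWithin] with δ hδ using hbound δ hδ)
  rw [zero_div, zero_mul] at this
  exact abs_nonpos_iff.1 this

end Local

/-! ### Globalisation by a partition of unity -/

theorem IsC1DefiningFunction.mono {d : ℕ} {O U V : Set (EuclideanSpace ℝ (Fin d))}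
    {p q : EuclideanSpace ℝ (Fin d)} {ρ : EuclideanSpace ℝ (Fin d) → ℝ}
    (h : IsC1DefiningFunction O p U ρ) (hV : IsOpen V) (hVU : V ⊆ U) (hq : q ∈ V) :
    IsC1DefiningFunction O q V ρ where
  isOpen := hV
  mem := hq
  contDiffOn := h.contDiffOn.mono hVU
  gradient_ne_zero x hx := h.gradient_ne_zero x (hVU hx)
  inter_eq := by
    ext x
    constructor
    · rintro ⟨h1, h2⟩; exact ⟨h2, (h.mem_iff (hVU h2)).1 h1⟩
    · rintro ⟨h1, h2⟩; exact ⟨(h.mem_iff (hVU h1)).2 h2, h1⟩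

section Global

variable {d : ℕ} {O : Set (EuclideanSpace ℝ (Fin d))}
  {F : EuclideanSpace ℝ (Fin d) → EuclideanSpace ℝ (Fin d)}

theorem ContinuousOn.integrableOn_of_isBounded {g : EuclideanSpace ℝ (Fin d) → ℝ}
    (hObdd : Bornology.IsBounded O) (hg : ContinuousOn g (closure O)) : IntegrableOn g O :=
  (hg.integrableOn_compact hObdd.isCompact_closure).mono_set subset_closure

theorem integrableOn_fderiv_apply_add_mul_divWithin (hO : IsOpen O)
    (hObdd : Bornology.IsBounded O) (hC1 : HasC1Boundary O) (hF : ContDiffOn ℝ 1 F (closure O))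
    {φ : EuclideanSpace ℝ (Fin d) → ℝ} (hφ : ContDiff ℝ 1 φ) :
    IntegrableOn (fun x => fderiv ℝ φ x (F x) + φ x * divWithin (closure O) F x) O := by
  refine ContinuousOn.integrableOn_of_isBounded hObdd (ContinuousOn.add ?_ ?_)
  · exact (hφ.continuous_fderiv one_ne_zero).continuousOn.clm_apply hF.continuousOn
  · exact hφ.continuous.continuousOn.mul
      (hF.continuousOn_divWithin (hC1.uniqueDiffOn_closure hO))

/-- Every point of the closure has a neighbourhood in which the divergence theorem holds for a
tangent field multiplied by a test function. -/
theorem exists_isOpen_forall_setIntegral_eq_zero (hO : IsOpen O)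
    (hObdd : Bornology.IsBounded O) (hC1 : HasC1Boundary O) (hF : ContDiffOn ℝ 1 F (closure O))
    (htan : ∀ x ∈ frontier O, ∀ p U ρ, IsC1DefiningFunction O p U ρ → x ∈ U →
      fderiv ℝ ρ x (F x) = 0) {x : EuclideanSpace ℝ (Fin d)} (hx : x ∈ closure O) :
    ∃ V, IsOpen V ∧ x ∈ V ∧ ∀ φ : EuclideanSpace ℝ (Fin d) → ℝ, ContDiff ℝ 1 φ →
      tsupport φ ⊆ V → (∀ y, 0 ≤ φ y) →
      ∫ y in O, (fderiv ℝ φ y (F y) + φ y * divWithin (closure O) F y) = 0 := by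
  by_cases hxO : x ∈ O
  · refine ⟨O, hO, hxO, fun φ hφ hs _ => ?_⟩
    have hc : HasCompactSupport φ :=
      hObdd.isCompact_closure.of_isClosed_subset (isClosed_tsupport φ) (hs.trans subset_closure)
    have h := (integral_fderiv_apply_add_mul_div hO hφ hc hs (hF.mono subset_closure)).2
    rw [← setIntegral_eq_integral_of_forall_compl_eq_zero (s := O)] at h
    · rw [← h]
      refine setIntegral_congr_fun hO.measurableSet fun y hy => ?_
      have hn : closure O ∈ 𝓝 y := mem_of_superset (hO.mem_nhds hy) subset_closure
      simp only [divWithin, partialWithin_eq_fderiv hn]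
    · intro y hy
      have h0 : φ =ᶠ[𝓝 y] fun _ => 0 :=
        notMem_tsupport_iff_eventuallyEq.1 fun hys => hy (hs hys)
      rw [h0.fderiv_eq, h0.eq_of_nhds]
      simp
  · have hxf : x ∈ frontier O := by rw [frontier, hO.interior_eq]; exact ⟨hx, hxO⟩
    obtain ⟨U, ρ, h⟩ := hC1 x hxf
    set v := -gradient ρ x
    have hn : 0 < fderiv ℝ ρ x (gradient ρ x) := h.fderiv_gradient_pos h.mem
    -- Halving the value at x makes the bound strict, so it persists on a neighbourhood and yields
    -- the uniform constant c. Intersecting with a ball makes the supports compact.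
    have hv : fderiv ℝ ρ x v < -(fderiv ℝ ρ x (gradient ρ x) / 2) := by
      rw [map_neg]; linarith
    have hρ1 : ContinuousOn (fun y => fderiv ℝ ρ y v) U :=
      (h.contDiffOn.continuousOn_fderiv_of_isOpen h.isOpen le_rfl).clm_apply continuousOn_const
    have hev := (hρ1.continuousAt (h.isOpen.mem_nhds h.mem)).eventually (gt_mem_nhds hv)
    obtain ⟨V, hV, hVo, hxV⟩ := eventually_nhds_iff.1
      (hev.and ((h.isOpen.eventually_mem h.mem).and
        (Metric.isOpen_ball.eventually_mem (Metric.mem_ball_self one_pos))))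
    have hVU : V ⊆ U := fun y hy => (hV y hy).2.1
    refine ⟨V, hVo, hxV, fun φ hφ hs hφ0 => ?_⟩
    have hc : HasCompactSupport φ := by
      refine (isCompact_closedBall x 1).of_isClosed_subset (isClosed_tsupport φ) ?_
      exact fun y hy => Metric.ball_subset_closedBall (hV y (hs hy)).2.2
    have h' := h.mono hVo hVU hxV
    exact setIntegral_fderiv_apply_add_mul_divWithin_of_tangent h' hO hF
      (fun y hy hyV => htan y hy x V ρ h' hyV) hφ hc hs hφ0
      (integrableOn_fderiv_apply_add_mul_divWithin hO hObdd hC1 hF hφ) (half_pos hn)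
      fun y hy => (hV y hy).1.le

/-- The divergence theorem for a field which is tangent to the boundary. -/
theorem setIntegral_divWithin_eq_zero_of_tangent (hO : IsOpen O)
    (hObdd : Bornology.IsBounded O) (hC1 : HasC1Boundary O) (hF : ContDiffOn ℝ 1 F (closure O))
    (htan : ∀ x ∈ frontier O, ∀ p U ρ, IsC1DefiningFunction O p U ρ → x ∈ U →
      fderiv ℝ ρ x (F x) = 0) : ∫ x in O, divWithin (closure O) F x = 0 := by
  choose! V hVo hxV hV using fun x (hx : x ∈ closure O) =>
    exists_isOpen_forall_setIntegral_eq_zero hO hObdd hC1 hF htan hx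
  obtain ⟨t, ht, hcov⟩ := hObdd.isCompact_closure.elim_nhds_subcover V
    fun x hx => (hVo x hx).mem_nhds (hxV x hx)
  obtain ⟨f, hf⟩ := SmoothPartitionOfUnity.exists_isSubordinate
    (modelWithCornersSelf ℝ (EuclideanSpace ℝ (Fin d))) (isClosed_closure (s := O))
    (fun i : t => V i) (fun i => hVo i (ht i i.2)) (by simpa [iUnion_subtype] using hcov)
  have hC : ∀ i, ContDiff ℝ 1 (f i) := fun i =>
    (contMDiff_iff_contDiff.1 (f i).contMDiff).of_le (by simp)
  have hsum : ∀ x ∈ closure O, ∑ i, f i x = 1 := fun x hx => by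
    rw [← finsum_eq_sum_of_fintype]; exact f.sum_eq_one hx
  -- The partition sums to 1 near each point of O, so the terms produced by differentiating it
  -- cancel.
  have hdsum : ∀ x ∈ O, ∀ w, ∑ i, fderiv ℝ (f i) x w = 0 := fun x hx w => by
    have h1 : (fun y => ∑ i, f i y) =ᶠ[𝓝 x] fun _ => 1 := by
      filter_upwards [hO.mem_nhds hx] with y hy using hsum y (subset_closure hy)
    have h2 := h1.fderiv_eq (𝕜 := ℝ)
    rw [fderiv_fun_sum fun i _ => (hC i).differentiable one_ne_zero x] at h2
    simpa using congrArg (fun L => L w) h2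
  have e : ∀ x ∈ O, divWithin (closure O) F x =
      ∑ i, (fderiv ℝ (f i) x (F x) + f i x * divWithin (closure O) F x) := fun x hx => by
    rw [Finset.sum_add_distrib, ← Finset.sum_mul, hsum x (subset_closure hx), hdsum x hx]
    ring
  rw [setIntegral_congr_fun hO.measurableSet e, integral_finsetSum]
  · exact Finset.sum_eq_zero fun i _ => hV i (ht i i.2) (f i) (hC i) (hf i) (f.nonneg i)
  · exact fun i _ => integrableOn_fderiv_apply_add_mul_divWithin hO hObdd hC1 hF (hC i)

end Global

/-! ### The divergence of the symmetrised gradient -/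

section SecondDerivatives

variable {d : ℕ} {s : Set (EuclideanSpace ℝ (Fin d))}
  {b : EuclideanSpace ℝ (Fin d) → EuclideanSpace ℝ (Fin d)} {x : EuclideanSpace ℝ (Fin d)}

theorem ContDiffOn.partialWithin (hs : UniqueDiffOn ℝ s) (hb : ContDiffOn ℝ 2 b s) (j i : Fin d) :
    ContDiffOn ℝ 1 (partialWithin s j i b) s :=
  ((contDiffOn_euclidean.1 hb i).fderivWithin hs (by norm_num)).clm_apply contDiffOn_const

theorem fderivWithin_partialWithin (hs : UniqueDiffOn ℝ s) (hb : ContDiffOn ℝ 2 b s) (hx : x ∈ s)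
    (j i : Fin d) (v : EuclideanSpace ℝ (Fin d)) :
    fderivWithin ℝ (partialWithin s j i b) s x v =
      fderivWithin ℝ (fderivWithin ℝ (fun y => b y i) s) s x v (EuclideanSpace.single j 1) := by
  have h1 : ContDiffOn ℝ 1 (fderivWithin ℝ (fun y => b y i) s) s :=
    (contDiffOn_euclidean.1 hb i).fderivWithin hs (by norm_num)
  have h2 := fderivWithin_clm_apply (hs x hx) (h1.differentiableOn one_ne_zero x hx)
    (differentiableWithinAt_const (EuclideanSpace.single j (1 : ℝ)))
  have e : partialWithin s j i b =
    fun y => fderivWithin ℝ (fun y => b y i) s y (EuclideanSpace.single j 1) := rfl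
  rw [e, h2]
  simp

theorem laplacianWithin_apply (hs : UniqueDiffOn ℝ s) (hb : ContDiffOn ℝ 2 b s) (hx : x ∈ s)
    (i : Fin d) : InnerProductSpace.laplacianWithin b s x i =
      ∑ j, fderivWithin ℝ (partialWithin s j i b) s x (EuclideanSpace.single j 1) := by
  have h := (hb x hx).laplacianWithin_CLM_comp_left (l := EuclideanSpace.proj i) hs hx
  rw [InnerProductSpace.laplacianWithin_eq_iteratedFDerivWithin_orthonormalBasis _ hs hx
    (EuclideanSpace.basisFun (Fin d) ℝ)] at h
  have h' : InnerProductSpace.laplacianWithin b s x i =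
    (EuclideanSpace.proj i ∘ InnerProductSpace.laplacianWithin b s) x := rfl
  rw [h', ← h]
  refine Finset.sum_congr rfl fun j _ => ?_
  rw [iteratedFDerivWithin_two_apply' _ hs hx, fderivWithin_partialWithin hs hb hx]
  simp only [EuclideanSpace.basisFun_apply]
  rfl

/-- The divergence of the symmetrised gradient is `Δ b + ∇ div b`. -/
theorem sum_fderivWithin_partialWithin_add (hs : UniqueDiffOn ℝ s) (hb : ContDiffOn ℝ 2 b s)
    (hx : x ∈ s) (hxi : x ∈ closure (interior s)) (i : Fin d) :
    ∑ j, fderivWithin ℝ (fun y => partialWithin s j i b y + partialWithin s i j b y) s x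
      (EuclideanSpace.single j 1) = InnerProductSpace.laplacianWithin b s x i +
        fderivWithin ℝ (divWithin s b) s x (EuclideanSpace.single i 1) := by
  have hd : ∀ j i, DifferentiableWithinAt ℝ (partialWithin s j i b) s x := fun j i =>
    (hb.partialWithin hs j i).differentiableOn one_ne_zero x hx
  have e : divWithin s b = fun y => ∑ j, partialWithin s j j b y := rfl
  rw [laplacianWithin_apply hs hb hx, e, fderivWithin_fun_sum (hs x hx) fun j _ => hd j j,
    _root_.sum_apply, ← Finset.sum_add_distrib]
  refine Finset.sum_congr rfl fun j _ => ?_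
  rw [fderivWithin_fun_add (hs x hx) (hd j i) (hd i j), _root_.add_apply]
  congr 1
  rw [fderivWithin_partialWithin hs hb hx, fderivWithin_partialWithin hs hb hx]
  -- ∂ⱼ∂ᵢbʲ = ∂ᵢ∂ⱼbʲ; at boundary points this symmetry passes to the limit from the interior.
  exact ((contDiffOn_euclidean.1 hb j) x hx).isSymmSndFDerivWithinAt (by simp) hs hxi hx _ _

theorem inner_eq_sum (v w : EuclideanSpace ℝ (Fin d)) : inner ℝ v w = ∑ i, v i * w i := by
  simp [PiLp.inner_apply, mul_comm]

/-- The symmetrised gradient of `b` applied to `b`. -/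
noncomputable def symGradApply (s : Set (EuclideanSpace ℝ (Fin d)))
    (b : EuclideanSpace ℝ (Fin d) → EuclideanSpace ℝ (Fin d)) (x : EuclideanSpace ℝ (Fin d)) :
    EuclideanSpace ℝ (Fin d) :=
  WithLp.toLp 2 fun j => ∑ i, (partialWithin s j i b x + partialWithin s i j b x) * b x i

theorem ContDiffOn.symGradApply (hs : UniqueDiffOn ℝ s) (hb : ContDiffOn ℝ 2 b s) :
    ContDiffOn ℝ 1 (symGradApply s b) s :=
  contDiffOn_euclidean.2 fun j => by
    simp only [_root_.symGradApply]
    exact ContDiffOn.sum fun i _ =>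
      ((hb.partialWithin hs j i).add (hb.partialWithin hs i j)).mul
        ((contDiffOn_euclidean.1 hb i).of_le (by norm_num))

/-- The product rule gives ⟨div S, b⟩ + ∑ Sᵢⱼ ∂ⱼbⁱ. Here div S = Δb because div b = 0, and averaging
the second sum with its index swap gives |S|²/2. -/
theorem divWithin_symGradApply (hs : UniqueDiffOn ℝ s) (hb : ContDiffOn ℝ 2 b s)
    (hx : x ∈ s) (hxi : x ∈ closure (interior s)) (hdiv : ∀ y ∈ s, divWithin s b y = 0) :
    divWithin s (symGradApply s b) x = inner ℝ (InnerProductSpace.laplacianWithin b s x) (b x) +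
      (∑ i, ∑ j, (partialWithin s j i b x + partialWithin s i j b x) ^ 2) / 2 := by
  have hS : ∀ j i, DifferentiableWithinAt ℝ
      (fun y => partialWithin s j i b y + partialWithin s i j b y) s x := fun j i =>
    ((hb.partialWithin hs j i).add (hb.partialWithin hs i j)).differentiableOn one_ne_zero x hx
  have hbi : ∀ i, DifferentiableWithinAt ℝ (fun y => b y i) s x := fun i =>
    (contDiffOn_euclidean.1 hb i).differentiableOn two_ne_zero x hx
  have hdiv0 : fderivWithin ℝ (divWithin s b) s x = 0 := by
    rw [fderivWithin_congr (f := fun _ => (0 : ℝ)) hdiv (hdiv x hx)]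
    simp
  have hlap : ∀ i, InnerProductSpace.laplacianWithin b s x i =
      ∑ j, fderivWithin ℝ (fun y => partialWithin s j i b y + partialWithin s i j b y) s x
        (EuclideanSpace.single j 1) := fun i => by
    rw [sum_fderivWithin_partialWithin_add hs hb hx hxi, hdiv0]
    simp
  have h1 : divWithin s (symGradApply s b) x = ∑ j, ∑ i,
      (fderivWithin ℝ (fun y => partialWithin s j i b y + partialWithin s i j b y) s x
        (EuclideanSpace.single j 1) * b x i +
      (partialWithin s j i b x + partialWithin s i j b x) * partialWithin s j i b x) := by
    refine Finset.sum_congr rfl fun j _ => ?_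
    have e : (fun y => symGradApply s b y j) = fun y => ∑ i,
      (partialWithin s j i b y + partialWithin s i j b y) * b y i := rfl
    rw [partialWithin, e, fderivWithin_fun_sum (hs x hx) fun i _ => (hS j i).fun_mul (hbi i),
      _root_.sum_apply]
    refine Finset.sum_congr rfl fun i _ => ?_
    rw [fderivWithin_fun_mul (hs x hx) (hS j i) (hbi i)]
    simp only [_root_.add_apply, _root_.smul_apply, smul_eq_mul]
    rw [partialWithin]
    ring
  have h2 : ∑ j, ∑ i, (partialWithin s j i b x + partialWithin s i j b x) * partialWithin s j i b x
      = (∑ i, ∑ j, (partialWithin s j i b x + partialWithin s i j b x) ^ 2) / 2 := by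
    have hsw : ∑ j, ∑ i, (partialWithin s j i b x + partialWithin s i j b x) *
        partialWithin s j i b x = ∑ j, ∑ i, (partialWithin s j i b x + partialWithin s i j b x) *
        partialWithin s i j b x := by
      rw [Finset.sum_comm]
      exact Finset.sum_congr rfl fun j _ => Finset.sum_congr rfl fun i _ => by ring
    rw [eq_div_iff two_ne_zero, mul_two]
    nth_rewrite 2 [hsw]
    simp only [← Finset.sum_add_distrib]
    rw [Finset.sum_comm]
    exact Finset.sum_congr rfl fun j _ => Finset.sum_congr rfl fun i _ => by ring
  simp only [h1, Finset.sum_add_distrib, h2]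
  rw [inner_eq_sum, Finset.sum_comm]
  simp only [hlap, Finset.sum_mul]

end SecondDerivatives

/-! ### The characterisation of Killing fields -/

theorem eq_zero_of_setIntegral_eq_zero {d : ℕ} {O : Set (EuclideanSpace ℝ (Fin d))}
    {g : EuclideanSpace ℝ (Fin d) → ℝ} (hO : IsOpen O) (hObdd : Bornology.IsBounded O)
    (hg : ContinuousOn g (closure O)) (hg0 : ∀ x, 0 ≤ g x) (h : ∫ x in O, g x = 0) :
    ∀ x ∈ closure O, g x = 0 := by
  have h1 := (setIntegral_eq_zero_iff_of_nonneg_ae (Eventually.of_forall hg0)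
    (hg.integrableOn_of_isBounded hObdd)).1 h
  have h2 : EqOn g (fun _ => 0) O := Measure.eqOn_open_of_ae_eq h1 hO (hg.mono subset_closure)
    continuousOn_const
  exact h2.of_subset_closure hg continuousOn_const subset_closure le_rfl

theorem lemmaA2 {d : ℕ} (O : Set (EuclideanSpace ℝ (Fin d)))
    (hO : IsOpen O) (hObdd : Bornology.IsBounded O) (hC1 : HasC1Boundary O)
    (ν : EuclideanSpace ℝ (Fin d) → EuclideanSpace ℝ (Fin d)) (hν : IsOuterUnitNormal O ν)
    (b : EuclideanSpace ℝ (Fin d) → EuclideanSpace ℝ (Fin d))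
    (hb : ContDiffOn ℝ 2 b (closure O)) :
    IsKillingOn (closure O) b ↔
      (∀ x ∈ closure O,
        inner ℝ (InnerProductSpace.laplacianWithin b (closure O) x) (b x) = 0) ∧
      (∀ x ∈ closure O, divWithin (closure O) b x = 0) ∧
      (∀ x ∈ frontier O,
        ∑ i : Fin d, ∑ j : Fin d,
          (partialWithin (closure O) j i b x + partialWithin (closure O) i j b x)
            * ν x j * b x i = 0) := by
  have hs : UniqueDiffOn ℝ (closure O) := hC1.uniqueDiffOn_closure hO
  have hint : closure O ⊆ closure (interior (closure O)) :=
    closure_mono (interior_maximal subset_closure hO)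
  constructor
  · rintro ⟨-, hK⟩
    have hdiv : ∀ x ∈ closure O, divWithin (closure O) b x = 0 := fun x hx =>
      Finset.sum_eq_zero fun i _ => by linarith [hK x hx i i]
    refine ⟨fun x hx => ?_, hdiv, fun x hx => ?_⟩
    · rw [inner_eq_sum]
      refine Finset.sum_eq_zero fun i _ => ?_
      -- In div S = Δb + ∇ div b both S and div b vanish, so Δb itself is zero.
      have h := sum_fderivWithin_partialWithin_add hs hb hx (hint hx) i
      rw [fderivWithin_congr (f := fun _ => (0 : ℝ)) hdiv (hdiv x hx),
        Finset.sum_eq_zero fun j _ => by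
          rw [fderivWithin_congr (f := fun _ => (0 : ℝ)) (fun y hy => hK y hy i j) (hK x hx i j)]
          simp] at h
      have h0 : InnerProductSpace.laplacianWithin b (closure O) x i = 0 := by simpa using h.symm
      rw [h0, zero_mul]
    · refine Finset.sum_eq_zero fun i _ => Finset.sum_eq_zero fun j _ => ?_
      rw [hK x (frontier_subset_closure hx) i j]
      ring
  · rintro ⟨hlap, hdiv, hbd⟩
    refine ⟨hb.of_le (by norm_num), ?_⟩
    -- The boundary condition is ⟨ν, Sb⟩ = 0. It concerns the defining function behind ν and carries
    -- over to any other, since the tangent spaces agree.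
    have htan : ∀ x ∈ frontier O, ∀ p U ρ, IsC1DefiningFunction O p U ρ → x ∈ U →
        fderiv ℝ ρ x (symGradApply (closure O) b x) = 0 := by
      intro x hx p U ρ h hxU
      obtain ⟨U', σ, h', hνx⟩ := hν x hx
      refine h'.fderiv_eq_zero h hO hx h'.mem hxU ?_
      have h1 : inner ℝ (ν x) (symGradApply (closure O) b x) = 0 := by
        rw [inner_eq_sum, ← hbd x hx, Finset.sum_comm]
        refine Finset.sum_congr rfl fun j _ => ?_
        simp only [symGradApply, Finset.mul_sum]
        exact Finset.sum_congr rfl fun i _ => by ring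
      rw [hνx, real_inner_smul_left, IsC1DefiningFunction.inner_gradient, mul_eq_zero] at h1
      exact h1.resolve_left (inv_ne_zero (norm_ne_zero_iff.2 (h'.gradient_ne_zero x h'.mem)))
    have hI := setIntegral_divWithin_eq_zero_of_tangent hO hObdd hC1 (hb.symGradApply hs) htan
    have e : EqOn (divWithin (closure O) (symGradApply (closure O) b)) (fun x =>
        (∑ i, ∑ j, (partialWithin (closure O) j i b x + partialWithin (closure O) i j b x) ^ 2) / 2)
        O := fun x hx => by
      have hxc := subset_closure hx
      simp only [divWithin_symGradApply hs hb hxc (hint hxc) hdiv, hlap x hxc, zero_add]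
    rw [setIntegral_congr_fun hO.measurableSet e] at hI
    have hc : ∀ j i, ContinuousOn (partialWithin (closure O) j i b) (closure O) := fun j i =>
      (hb.partialWithin hs j i).continuousOn
    have hz := eq_zero_of_setIntegral_eq_zero hO hObdd
      ((continuousOn_finsetSum _ fun i _ => continuousOn_finsetSum _ fun j _ =>
        ((hc j i).add (hc i j)).pow 2).div_const 2)
      (fun x => div_nonneg (Finset.sum_nonneg fun i _ => Finset.sum_nonneg fun j _ => sq_nonneg _)
        zero_le_two) hI
    intro x hx i j
    have h0 : (∑ i, ∑ j, (partialWithin (closure O) j i b x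
      + partialWithin (closure O) i j b x) ^ 2) / 2 = 0 := hz x hx
    rw [div_eq_zero_iff, or_iff_left two_ne_zero,
      Finset.sum_eq_zero_iff_of_nonneg fun i _ => by positivity] at h0
    have h1 := h0 i (Finset.mem_univ i)
    rw [Finset.sum_eq_zero_iff_of_nonneg fun j _ => by positivity] at h1
    exact pow_eq_zero_iff two_ne_zero |>.1 (h1 j (Finset.mem_univ j))
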